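/- Let $(X,\mathcal B,\mu)$ be a standard Borel space with a nonzero, atomless, $\sigma$-finite measure, and let $T$ be an action of a group $\mathbb G$ on $X$ by measurable, $\mu$-preserving transformations. For a measurable space $Y$ let $Y^*$ be the space of countable subsets of $Y$ with the $\sigma$-algebra generated by the events $\{|\omega\cap B|=n\}$ ($B$ measurable, $n\ge 0$); for a measure $\nu$ on $Y$ let $\nu^*$ be the law on $Y^*$ of the Poisson process of intensity $\nu$: the counts $|\omega\cap B|$ are Poisson distributed with mean $\nu(B)$ (almost surely infinite if $\nu(B)=\infty$), and counts of disjoint measurable sets are independent. For an action $R$ of $\mathbb G$ on $Y$ let $R_*$ be the action $(R_*)_g\,\omega=\{R_g y: y\in\omega\}$ on $Y^*$. An action is ergodic if every measurable set that is invariant modulo null sets under each group element is null or co-null. A (possibly fractional) Poisson allocation is a measurable map $\Upsilon:X\times X^*\to L^1(\mu)$ such that (A1) $\Upsilon_{(x,\omega)}\ge 0$ for all $(x,\omega)$; (A2) for $\mu^*$-a.e. $\omega$, $\sum_{x\in\omega}\Upsilon_{(x,\omega)}(y)=1$ for $\mu$-a.e. $y$; (A3) $\Upsilon_{(x,\omega)}=0$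 if $x\notin\omega$. An almost-everywhere Poisson allocation is a map $\Upsilon:X\times X^*\to L^1(\mu)$ such that $(x,\omega)\mapsto\Upsilon_{(x,\{x\}\cup\omega)}$ is $\mu\times\mu^*$-a.e. equal to a measurable map, (A1) holds for $\mu^*$-a.e. $\omega$ and all $x\in\omega$, and (A2) holds. In either case $\Upsilon$ is $T$-equivariant if for every $g\in\mathbb G$, for $\mu^*$-a.e. $\omega$ and all $x\in\omega$, one has $\Upsilon_{(T_gx,(T_*)_g\omega)}\circ T_g=\Upsilon_{(x,\omega)}$ $\mu$-a.e. Let $S=T\times T_*$, acting on $(X\times X^*,\mu\times\mu^*)$. If $S\times S_*$, acting on $\big((X\times X^*)\times(X\times X^*)^*,\ (\mu\times\mu^*)\times(\mu\times\mu^*)^*\big)$, is ergodic, then there is no $T$-equivariant Poisson allocation, and there is no $T$-equivariant almost-everywhere Poisson allocation. -/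

import Mathlib

open MeasureTheory Set Filter

/-- The configuration space `X^*`: the countable subsets of `X`. -/
@[ext]
structure CountableConfig (X : Type*) where
  carrier : Set X
  countable : carrier.Countable

namespace CountableConfig

/-- The number `|ω ∩ B|` of points of `ω` in `B`, possibly infinite. -/
noncomputable def count {X : Type*} (B : Set X) (ω : CountableConfig X) : ℕ∞ :=
  (ω.carrier ∩ B).encard

/-- The σ-algebra `𝓑^*`, generated by the events `|ω ∩ B| = n` with `B` measurable and `n : ℕ`. -/
instance instMeasurableSpaceCountableConfig {X : Type*} [MeasurableSpace X] :
    MeasurableSpace (CountableConfig X) :=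
  MeasurableSpace.generateFrom
    {E | ∃ (B : Set X) (n : ℕ), MeasurableSet B ∧ E = {ω | count B ω = n}}

/-- The action `T_*` on configurations: `g • ω = {g • x | x ∈ ω}`. -/
instance instMulActionCountableConfig {G X : Type*} [Group G] [MulAction G X] :
    MulAction G (CountableConfig X) where
  smul g ω := ⟨(fun x => g • x) '' ω.carrier, ω.countable.image _⟩
  one_smul ω := by
    ext x
    change x ∈ (fun x => (1 : G) • x) '' ω.carrier ↔ _
    simp
  mul_smul g h ω := by
    ext x
    change x ∈ (fun x => (g * h) • x) '' ω.carrier ↔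
      x ∈ (fun x => g • x) '' ((fun x => h • x) '' ω.carrier)
    simp only [Set.mem_image, exists_exists_and_eq_and, mul_smul]

/-- The configuration `{x} ∪ ω`. -/
def addPoint {X : Type*} (x : X) (ω : CountableConfig X) : CountableConfig X :=
  ⟨insert x ω.carrier, ω.countable.insert x⟩

end CountableConfig

open CountableConfig

/-- `P` is the law `μ^*` of the Poisson point process with intensity `μ`: the number of points in a
measurable set `B` is Poisson distributed with mean `μ B` (almost surely infinite if `μ B = ∞`), and
the numbers of points in pairwise disjoint measurable sets are jointly independent. -/
structure IsPoissonProcessLaw {X : Type*} [MeasurableSpace X] (μ : Measure X)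
    (P : Measure (CountableConfig X)) : Prop where
  isProbabilityMeasure : IsProbabilityMeasure P
  count_of_ne_top : ∀ B : Set X, MeasurableSet B → μ B ≠ ⊤ → ∀ k : ℕ,
    P {ω | count B ω = k} =
      ENNReal.ofReal (Real.exp (-(μ B).toReal) * (μ B).toReal ^ k / (k.factorial : ℝ))
  count_of_eq_top : ∀ B : Set X, MeasurableSet B → μ B = ⊤ → ∀ᵐ ω ∂P, count B ω = ⊤
  iIndepFun_count : ∀ (n : ℕ) (A : Fin n → Set X), (∀ i, MeasurableSet (A i)) →
    Pairwise (fun i j => Disjoint (A i) (A j)) →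
    ProbabilityTheory.iIndepFun (fun i ω => count (A i) ω) P

/-- A (possibly fractional) Poisson allocation rule `Υ : X × X^* → L¹(μ)`. The representative values
`Υ (x, ω) y` are not required to be `0` or `1`. -/
structure IsPoissonAllocation {X : Type*} [MeasurableSpace X] (μ : Measure X)
    (P : Measure (CountableConfig X)) (Υ : X × CountableConfig X → Lp ℝ 1 μ) : Prop where
  measurable : StronglyMeasurable Υ
  nonneg : ∀ x ω, 0 ≤ Υ (x, ω)
  partition_of_unity : ∀ᵐ ω ∂P, ∀ᵐ y ∂μ, HasSum (fun x : ω.carrier => Υ (x, ω) y) 1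
  eq_zero : ∀ x ω, x ∉ ω.carrier → Υ (x, ω) = 0

/-- A (possibly fractional) Poisson allocation in the almost everywhere sense: `Υ (x, ω)` matters
only for almost every `ω` and the points `x` of `ω`, and measurability is only required up to
modification on a null set of pairs `(x, ω)` with `x ∈ ω`. Null sets of such pairs are those of the
Campbell measure `E ↦ 𝔼 #{x ∈ ω | (x, ω) ∈ E}`, the image of `μ × P` under
`(x, ω) ↦ (x, {x} ∪ ω)`. -/
structure IsAEPoissonAllocation {X : Type*} [MeasurableSpace X] (μ : Measure X)
    (P : Measure (CountableConfig X)) (Υ : X × CountableConfig X → Lp ℝ 1 μ) : Prop where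
  aemeasurable : AEStronglyMeasurable (fun p => Υ (p.1, addPoint p.1 p.2)) (μ.prod P)
  nonneg : ∀ᵐ ω ∂P, ∀ x ∈ ω.carrier, 0 ≤ Υ (x, ω)
  partition_of_unity : ∀ᵐ ω ∂P, ∀ᵐ y ∂μ, HasSum (fun x : ω.carrier => Υ (x, ω) y) 1

/-- Equivariance `Υ_(T x, T_* ω) ∘ T = Υ_(x, ω)`, for each group element, almost every `ω` and all
points `x` of `ω`. -/
def IsEquivariantAllocation (G : Type*) {X : Type*} [Group G] [MulAction G X] [MeasurableSpace X]
    (μ : Measure X) (P : Measure (CountableConfig X))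
    (Υ : X × CountableConfig X → Lp ℝ 1 μ) : Prop :=
  ∀ g : G, ∀ᵐ ω ∂P, ∀ x ∈ ω.carrier,
    (fun y => Υ (g • x, g • ω) (g • y)) =ᵐ[μ] (fun y => Υ (x, ω) y)

/-! For `z = (x, ω)` let `f z` be `Υ (x, {x} ∪ ω)`, modified on a null set to be measurable into the
separable space `L¹(μ)`. Equivariance and invariance of `μ` make `dist (f z) (f z')` invariant under
the diagonal action. Hence the event that no point `z'` of the second Poisson process has `f z'`
within `ε` of `f z` is invariant modulo null sets, and ergodicity makes it null or conull. So the
`ε`-ball around `f z` has a preimage of measure `0` for a.e. `z`, or of measure `∞` for a.e. `z`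
(`ae_measure_ball_eq_zero_or_top`). Separability rules out `0` (`ae_measure_ball_eq_top`).

On the other hand, the Mecke (reduced Campbell) formula turns the partition of unity into `∫ (∫_B |f
z| dμ) d(μ × P) = μ B` (`lintegral_setLIntegral_enorm`). Choose `z` with `f z ≠ 0` and all balls of
infinite measure, and `B` of finite measure with `∫_B |f z| > 0`. Values near `f z` keep at least
half of this mass in `B`, and they occur on a set of infinite measure, which contradicts `μ B < ∞`.
-/

open scoped ENNReal

/-! ### Counts, and adding or erasing a point. -/

namespace CountableConfig

variable {X Y G : Type*}

theorem count_eq_zero {B : Set X} {ω : CountableConfig X} :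
    count B ω = 0 ↔ ∀ x ∈ ω.carrier, x ∉ B := by
  rw [count, encard_eq_zero, ← disjoint_iff_inter_eq_empty, disjoint_left]

theorem count_iUnion {ι : Type*} [Fintype ι] (B : ι → Set X)
    (hB : Pairwise (Function.onFun Disjoint B)) (ω : CountableConfig X) :
    count (⋃ i, B i) ω = ∑ i, count (B i) ω := by
  rw [count, inter_iUnion, encard_iUnion_of_finite, finsum_eq_sum_of_fintype]
  · rfl
  · exact fun i j h => (hB h).mono inter_subset_right inter_subset_right

theorem count_union {A B : Set X} (h : Disjoint A B) (ω : CountableConfig X) :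
    count (A ∪ B) ω = count A ω + count B ω := by
  rw [count, inter_union_distrib_left, encard_union_eq]
  · rfl
  · exact h.mono inter_subset_right inter_subset_right

/-- The configuration `ω \ {x}`. -/
def erasePoint {X : Type*} (x : X) (ω : CountableConfig X) : CountableConfig X :=
  ⟨ω.carrier \ {x}, ω.countable.mono sdiff_subset⟩

theorem addPoint_erasePoint {x : X} {ω : CountableConfig X} (h : x ∈ ω.carrier) :
    addPoint x (erasePoint x ω) = ω := by
  ext y
  simp [addPoint, erasePoint, h]

open Classical in
theorem count_erasePoint {x : X} {ω : CountableConfig X} (h : x ∈ ω.carrier) (B : Set X) :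
    count B ω = count B (erasePoint x ω) + if x ∈ B then 1 else 0 := by
  have e : (erasePoint x ω).carrier ∩ B = (ω.carrier ∩ B) \ {x} := by
    ext y; simp [erasePoint]; tauto
  rw [count, count, e]
  split_ifs with hx
  · exact (encard_sdiff_singleton_add_one (mem_inter h hx)).symm
  · rw [add_zero, sdiff_singleton_eq_self (fun h' => hx h'.2)]

open Classical in
theorem count_addPoint {x : X} {ω : CountableConfig X} (h : x ∉ ω.carrier) (B : Set X) :
    count B (addPoint x ω) = count B ω + if x ∈ B then 1 else 0 := by
  split_ifs with hx
  · rw [count, addPoint, insert_inter_of_mem hx, encard_insert_of_notMem (fun h' => h h'.1)]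
    rfl
  · rw [count, addPoint, insert_inter_of_notMem hx, add_zero]
    rfl

section Action

variable [Group G] [MulAction G X]

theorem count_smul (g : G) (B : Set X) (ω : CountableConfig X) :
    count B (g • ω) = count ((g • ·) ⁻¹' B) ω := by
  rw [count, count, ← (MulAction.injective g).encard_image (ω.carrier ∩ _),
    image_inter_preimage]
  rfl

theorem smul_addPoint (g : G) (x : X) (ω : CountableConfig X) :
    g • addPoint x ω = addPoint (g • x) (g • ω) := by
  ext y
  change y ∈ (fun x => g • x) '' (insert x ω.carrier) ↔
    y ∈ insert (g • x) ((fun x => g • x) '' ω.carrier)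
  rw [image_insert_eq]

end Action

variable [MeasurableSpace X] [MeasurableSpace Y]

theorem measurable_count {B : Set X} (hB : MeasurableSet B) : Measurable (count B) := by
  have key : ∀ n : ℕ, MeasurableSet (count B ⁻¹' {(n : ℕ∞)}) := fun n =>
    MeasurableSpace.measurableSet_generateFrom ⟨B, n, hB, rfl⟩
  refine measurable_to_countable' fun n => ?_
  induction n using ENat.recTopCoe with
  | coe n => exact key n
  | top =>
    have : count B ⁻¹' {(⊤ : ℕ∞)} = (⋃ n : ℕ, count B ⁻¹' {(n : ℕ∞)})ᶜ := by
      ext ω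
      simp only [mem_preimage, mem_singleton_iff, mem_compl_iff, mem_iUnion, not_exists]
      constructor
      · intro h n
        simp [h]
      · intro h
        by_contra h'
        exact h _ (ENat.natCast_toNat h').symm
    rw [this]
    exact (MeasurableSet.iUnion key).compl

theorem measurable_of_measurable_count {f : Y → CountableConfig X}
    (hf : ∀ B, MeasurableSet B → Measurable fun y => count B (f y)) : Measurable f := by
  refine measurable_generateFrom ?_
  rintro _ ⟨B, n, hB, rfl⟩
  exact hf B hB (measurableSet_singleton (n : ℕ∞))

instance [Group G] [MulAction G X] [MeasurableConstSMul G X] : MeasurableConstSMul G (CountableConfig X) where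
  measurable_const_smul g := measurable_of_measurable_count fun B hB => by
    change Measurable fun ω : CountableConfig X => count B (g • ω)
    simp_rw [count_smul]
    exact measurable_count (measurable_const_smul g hB)

end CountableConfig

/-! ### Void probabilities and independence of counts. -/

namespace IsPoissonProcessLaw

variable {X : Type*} [MeasurableSpace X] {μ : Measure X} {P : Measure (CountableConfig X)}

theorem ae_count_eq_zero (hP : IsPoissonProcessLaw μ P) {N : Set X} (hN : MeasurableSet N)
    (h0 : μ N = 0) : ∀ᵐ ω ∂P, count N ω = 0 := by
  have := hP.isProbabilityMeasure
  have h := hP.count_of_ne_top N hN (by simp [h0]) 0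
  simp only [h0, CharP.cast_eq_zero, ENNReal.toReal_zero, neg_zero, Real.exp_zero, pow_zero,
    mul_one, Nat.factorial_zero, Nat.cast_one, div_one, ENNReal.ofReal_one] at h
  exact mem_ae_iff_prob_eq_one (measurable_count hN (measurableSet_singleton 0)) |>.mpr h

theorem ae_forall_mem (hP : IsPoissonProcessLaw μ P) {p : X → Prop} (hp : ∀ᵐ x ∂μ, p x) :
    ∀ᵐ ω ∂P, ∀ x ∈ ω.carrier, p x := by
  filter_upwards [hP.ae_count_eq_zero (measurableSet_toMeasurable μ {x | ¬ p x})
    (by rw [measure_toMeasurable]; exact hp)] with ω hω x hx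
  by_contra h
  exact count_eq_zero.mp hω x hx (subset_toMeasurable μ _ h)

theorem count_eq_zero_prob (hP : IsPoissonProcessLaw μ P) {B : Set X} (hB : MeasurableSet B)
    (h : μ B ≠ ⊤) : P {ω | count B ω = 0} = ENNReal.ofReal (Real.exp (-(μ B).toReal)) := by
  simpa using hP.count_of_ne_top B hB h 0

/-- A measurable set that almost surely contains no point of the process is null. -/
theorem measure_eq_zero (hP : IsPoissonProcessLaw μ P) {B : Set X} (hB : MeasurableSet B)
    (h : ∀ᵐ ω ∂P, count B ω = 0) : μ B = 0 := by
  have := hP.isProbabilityMeasure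
  by_cases hT : μ B = ⊤
  · obtain ⟨ω, h1, h2⟩ := (h.and (hP.count_of_eq_top B hB hT)).exists
    simp [h1] at h2
  · have h1 : P {ω | count B ω = 0} = 1 := mem_ae_iff_prob_eq_one
      (measurable_count hB (measurableSet_singleton 0)) |>.mp h
    rw [hP.count_eq_zero_prob hB hT, ENNReal.ofReal_eq_one, Real.exp_eq_one_iff, neg_eq_zero,
      ENNReal.toReal_eq_zero_iff] at h1
    exact h1.resolve_right hT

/-- A measurable set that almost surely contains a point of the process has infinite measure. -/
theorem measure_eq_top (hP : IsPoissonProcessLaw μ P) {B : Set X} (hB : MeasurableSet B)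
    (h : ∀ᵐ ω ∂P, count B ω ≠ 0) : μ B = ⊤ := by
  by_contra hT
  have h1 : P {ω | count B ω = 0} = 0 := by
    rw [ae_iff] at h
    simpa using h
  rw [hP.count_eq_zero_prob hB hT, ENNReal.ofReal_eq_zero] at h1
  exact absurd (Real.exp_pos _) (not_lt.mpr h1)

/-- This is `1 - exp (-t) ≤ t` applied to the void probability. -/
theorem prob_count_ne_zero_le (hP : IsPoissonProcessLaw μ P) {B : Set X} (hB : MeasurableSet B) :
    P {ω | count B ω ≠ 0} ≤ μ B := by
  have := hP.isProbabilityMeasure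
  by_cases hT : μ B = ⊤
  · simp [hT]
  have hc : {ω | count B ω ≠ 0} = {ω | count B ω = 0}ᶜ := rfl
  have hm : MeasurableSet {ω | count B ω = 0} := measurable_count hB (measurableSet_singleton 0)
  rw [hc, prob_compl_eq_one_sub hm,
    hP.count_eq_zero_prob hB hT, ← ENNReal.ofReal_one,
    ← ENNReal.ofReal_sub _ (Real.exp_pos _).le]
  refine (ENNReal.ofReal_le_ofReal ?_).trans_eq (ENNReal.ofReal_toReal hT)
  linarith [Real.add_one_le_exp (-(μ B).toReal)]

theorem iIndepFun_count_fintype (hP : IsPoissonProcessLaw μ P) {ι : Type*} [Fintype ι]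
    (A : ι → Set X) (hA : ∀ i, MeasurableSet (A i)) (hd : Pairwise (Function.onFun Disjoint A)) :
    ProbabilityTheory.iIndepFun (fun i ω => count (A i) ω) P := by
  have e := Fintype.equivFin ι
  have h := hP.iIndepFun_count _ (fun i => A (e.symm i)) (fun i => hA _)
    (fun i j hij => hd (e.symm.injective.ne hij))
  simpa using h.precomp e.injective

/-- The sets `B i` may overlap, so they are cut into the atoms `D s` that they generate outside `A`.
The atoms and `A` are pairwise disjoint, and each `count (B i)` is a sum of counts of atoms. -/
theorem indepFun_count (hP : IsPoissonProcessLaw μ P) {ι : Type*} [Fintype ι]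
    {A : Set X} (hA : MeasurableSet A) (B : ι → Set X) (hB : ∀ i, MeasurableSet (B i))
    (hd : ∀ i, Disjoint A (B i)) :
    ProbabilityTheory.IndepFun (count A) (fun ω i => count (B i) ω) P := by
  classical
  let D : Set ι → Set X := fun s => {x | x ∉ A ∧ ∀ i, x ∈ B i ↔ i ∈ s}
  have hDm : ∀ s, MeasurableSet (D s) := fun s => by
    have : D s = Aᶜ ∩ ⋂ i, {x | x ∈ B i ↔ i ∈ s} := by ext; simp [D]
    rw [this]
    refine hA.compl.inter (MeasurableSet.iInter fun i => ?_)
    by_cases h : i ∈ s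
    · simpa [h] using hB i
    · have : {x | x ∈ B i ↔ i ∈ s} = (B i)ᶜ := by ext; simp [h]
      exact this ▸ (hB i).compl
  have hDd : ∀ s t, s ≠ t → Disjoint (D s) (D t) := fun s t hst => by
    rw [disjoint_left]
    rintro x ⟨_, hs⟩ ⟨_, ht⟩
    exact hst (Set.ext fun i => (hs i).symm.trans (ht i))
  have hDB : ∀ i, B i = ⋃ s : {s : Set ι // i ∈ s}, D s := fun i => by
    ext x
    simp only [mem_iUnion, Subtype.exists, D, mem_ofPred_eq]
    refine ⟨fun h => ⟨{j | x ∈ B j}, h, fun h' => disjoint_left.mp (hd i) h' h, fun j => Iff.rfl⟩, ?_⟩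
    rintro ⟨s, hs, _, h⟩
    exact (h i).mpr hs
  let C : Option (Set ι) → Set X := fun o => o.elim A D
  have hC := hP.iIndepFun_count_fintype C
    (by rintro (_ | s); exacts [hA, hDm s])
    (by
      rintro (_ | s) (_ | t) hst
      · exact absurd rfl hst
      · exact disjoint_left.mpr fun x hx hx' => hx'.1 hx
      · exact disjoint_left.mpr fun x hx hx' => hx.1 hx'
      · exact hDd s t (fun h => hst (by rw [h])))
  have hCm : ∀ o, Measurable fun ω => count (C o) ω := by
    rintro (_ | s); exacts [measurable_count hA, measurable_count (hDm s)]
  let U : Finset (Option (Set ι)) := Finset.univ.erase none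
  have h := hC.indepFun_finset {none} U (by simp [U]) hCm
  let φ : (({none} : Finset (Option (Set ι))) → ℕ∞) → ℕ∞ := fun v => v ⟨none, by simp⟩
  let ψ : (U → ℕ∞) → ι → ℕ∞ :=
    fun v i => ∑ s : {s : Set ι // i ∈ s}, v ⟨some s.1, by simp [U]⟩
  have hφ : Measurable φ := measurable_pi_apply _
  have hψ : Measurable ψ := measurable_pi_lambda _ fun i =>
    Finset.measurable_fun_sum Finset.univ fun s _ => measurable_pi_apply _
  have h' := h.comp hφ hψ
  suffices e : (fun ω i => count (B i) ω) = ψ ∘ fun ω (o : U) => count (C o) ω from e ▸ h'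
  funext ω i
  rw [hDB i, count_iUnion]
  · rfl
  · exact fun s t hst => hDd _ _ (fun h => hst (Subtype.ext h))

end IsPoissonProcessLaw

/-! ### The reduced Campbell kernel. -/

namespace CountableConfig

variable {X : Type*} [MeasurableSpace X]

/-- Rectangles `A × E` where `E` prescribes the counts of finitely many measurable sets, each of
which contains `A` or is disjoint from `A`. -/
def countRectangles (X : Type*) [MeasurableSpace X] : Set (Set (X × CountableConfig X)) :=
  {R | ∃ (A : Set X) (l : Finset (Set X × ℕ)), MeasurableSet A ∧
    (∀ p ∈ l, MeasurableSet p.1 ∧ (A ⊆ p.1 ∨ Disjoint A p.1)) ∧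
    R = A ×ˢ {ω | ∀ p ∈ l, count p.1 ω = p.2}}

theorem measurableSet_forall_count_eq {l : Finset (Set X × ℕ)} (hl : ∀ p ∈ l, MeasurableSet p.1)
    (n : Set X × ℕ → ℕ∞) : MeasurableSet {ω : CountableConfig X | ∀ p ∈ l, count p.1 ω = n p} := by
  have : {ω : CountableConfig X | ∀ p ∈ l, count p.1 ω = n p} =
      ⋂ p ∈ l, count p.1 ⁻¹' {n p} := by ext; simp
  rw [this]
  exact Finset.measurableSet_biInter l fun p hp =>
    measurable_count (hl p hp) (measurableSet_singleton _)

theorem isPiSystem_countRectangles : IsPiSystem (countRectangles X) := by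
  classical
  rintro _ ⟨A, l, hA, hl, rfl⟩ _ ⟨A', l', hA', hl', rfl⟩ _
  refine ⟨A ∩ A', l ∪ l', hA.inter hA', fun p hp => ?_, ?_⟩
  · rcases Finset.mem_union.mp hp with hp | hp
    · exact ⟨(hl p hp).1, (hl p hp).2.imp (inter_subset_left.trans ·)
        (Disjoint.mono_left inter_subset_left)⟩
    · exact ⟨(hl' p hp).1, (hl' p hp).2.imp (inter_subset_right.trans ·)
        (Disjoint.mono_left inter_subset_right)⟩
  · rw [prod_inter_prod]
    congr 1
    ext ω
    simp only [mem_inter_iff, mem_ofPred_eq, Finset.mem_union]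
    grind

/-- Requiring `A` to lie inside or outside each counted set loses nothing: a cylinder over `{count B
= n}` splits into its parts above `B` and above `Bᶜ`. -/
theorem generateFrom_countRectangles :
    (Prod.instMeasurableSpace : MeasurableSpace (X × CountableConfig X)) =
      MeasurableSpace.generateFrom (countRectangles X) := by
  refine le_antisymm (sup_le ?_ ?_) (MeasurableSpace.generateFrom_le ?_)
  · rintro _ ⟨A, hA, rfl⟩
    refine MeasurableSpace.measurableSet_generateFrom ⟨A, ∅, hA, by simp, ?_⟩
    ext; simp
  · rw [instMeasurableSpaceCountableConfig, MeasurableSpace.comap_generateFrom]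
    refine MeasurableSpace.generateFrom_le ?_
    rintro _ ⟨_, ⟨B, n, hB, rfl⟩, rfl⟩
    have e : (Prod.snd ⁻¹' {ω | count B ω = n} : Set (X × CountableConfig X)) =
        B ×ˢ {ω | ∀ p ∈ ({(B, n)} : Finset (Set X × ℕ)), count p.1 ω = p.2} ∪
        Bᶜ ×ˢ {ω | ∀ p ∈ ({(B, n)} : Finset (Set X × ℕ)), count p.1 ω = p.2} := by
      ext; simp; tauto
    rw [e]
    refine MeasurableSet.union ?_ ?_
    · exact MeasurableSpace.measurableSet_generateFrom
        ⟨B, {(B, n)}, hB, by simp [hB], rfl⟩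
    · exact MeasurableSpace.measurableSet_generateFrom
        ⟨Bᶜ, {(B, n)}, hB.compl, by simp [hB, disjoint_compl_left], rfl⟩
  · rintro _ ⟨A, l, hA, hl, rfl⟩
    exact hA.prod (measurableSet_forall_count_eq (fun p hp => (hl p hp).1) _)

open Classical in
/-- The measure `∑_{x ∈ ω ∩ A} δ_(x, ω \ {x})`, or `0` if `ω ∩ A` is infinite. -/
noncomputable def reducedCampbell (A : Set X) (ω : CountableConfig X) :
    Measure (X × CountableConfig X) :=
  if count A ω = ⊤ then 0 else
    Measure.sum fun x : (ω.carrier ∩ A : Set X) => Measure.dirac (x.1, erasePoint x.1 ω)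

theorem reducedCampbell_apply {A : Set X} {ω : CountableConfig X} (h : count A ω ≠ ⊤)
    {R : Set (X × CountableConfig X)} (hR : MeasurableSet R) :
    reducedCampbell A ω R =
      ∑' x : (ω.carrier ∩ A : Set X), R.indicator 1 (x.1, erasePoint x.1 ω) := by
  rw [reducedCampbell, if_neg h, Measure.sum_apply _ hR]
  simp_rw [Measure.dirac_apply' _ hR]

theorem lintegral_reducedCampbell {A : Set X} {ω : CountableConfig X} (h : count A ω ≠ ⊤)
    {F : X × CountableConfig X → ℝ≥0∞} (hF : Measurable F) :
    ∫⁻ z, F z ∂(reducedCampbell A ω) =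
      ∑' x : (ω.carrier ∩ A : Set X), F (x.1, erasePoint x.1 ω) := by
  rw [reducedCampbell, if_neg h, lintegral_sum_measure]
  simp_rw [lintegral_dirac' _ hF]

-- Erasing a point of `B` lowers the count of `p.1` by one exactly when `B ⊆ p.1`. The condition on
-- the erased configuration is therefore the same for every `x ∈ B`, and the sum just counts the
-- points of `A ∩ B`.
open Classical in
theorem reducedCampbell_rectangle {A : Set X} {ω : CountableConfig X} (h : count A ω ≠ ⊤)
    {B : Set X} {l : Finset (Set X × ℕ)} (hB : MeasurableSet B)
    (hl : ∀ p ∈ l, MeasurableSet p.1 ∧ (B ⊆ p.1 ∨ Disjoint B p.1)) :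
    reducedCampbell A ω (B ×ˢ {ω | ∀ p ∈ l, count p.1 ω = p.2}) =
      {ω | ∀ p ∈ l, count p.1 ω = p.2 + if B ⊆ p.1 then 1 else 0}.indicator
        (fun ω => (count (A ∩ B) ω : ℝ≥0∞)) ω := by
  rw [reducedCampbell_apply h
    (hB.prod (measurableSet_forall_count_eq (fun p hp => (hl p hp).1) _))]
  have key : ∀ x ∈ ω.carrier, (x, erasePoint x ω) ∈ B ×ˢ {ω | ∀ p ∈ l, count p.1 ω = p.2} ↔
      x ∈ B ∧ ω ∈ {ω | ∀ p ∈ l, count p.1 ω = p.2 + if B ⊆ p.1 then 1 else 0} := by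
    intro x hx
    rw [mem_prod]
    refine and_congr_right fun hxB => forall₂_congr fun p hp => ?_
    have : x ∈ p.1 ↔ B ⊆ p.1 := by
      refine ⟨fun hxp => (hl p hp).2.resolve_right fun hd => disjoint_left.mp hd hxB hxp,
        fun hs => hs hxB⟩
    rw [count_erasePoint hx, if_congr this rfl rfl]
    exact ((ENat.add_left_injective_of_ne_top (by split_ifs <;> simp)).eq_iff).symm
  by_cases hc : ω ∈ {ω | ∀ p ∈ l, count p.1 ω = p.2 + if B ⊆ p.1 then 1 else 0}
  · rw [indicator_of_mem hc, count, ← inter_assoc, ← ENNReal.tsum_set_one,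
      tsum_subtype (ω.carrier ∩ A ∩ B) (fun _ => (1 : ℝ≥0∞)), ← indicator_indicator,
      ← tsum_subtype]
    refine tsum_congr fun x => ?_
    simp only [indicator, key x.1 x.2.1, hc, and_true, Pi.one_apply]
  · rw [indicator_of_notMem hc]
    refine ENNReal.tsum_eq_zero.mpr fun x => indicator_of_notMem ?_ _
    rw [key x.1 x.2.1]
    exact fun h => hc h.2

theorem reducedCampbell_univ {A : Set X} {ω : CountableConfig X} (h : count A ω ≠ ⊤) :
    reducedCampbell A ω univ = count A ω := by
  simpa using reducedCampbell_rectangle (B := univ) (l := ∅) h MeasurableSet.univ (by simp)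

theorem reducedCampbell_of_eq_top {A : Set X} {ω : CountableConfig X} (h : count A ω = ⊤) :
    reducedCampbell A ω = 0 := if_pos h

instance (A : Set X) (ω : CountableConfig X) : IsFiniteMeasure (reducedCampbell A ω) where
  measure_univ_lt_top := by
    by_cases h : count A ω = ⊤
    · simp [reducedCampbell_of_eq_top h]
    · rw [reducedCampbell_univ h]
      exact lt_top_iff_ne_top.mpr (by simpa using h)

theorem measurable_reducedCampbell {A : Set X} (hA : MeasurableSet A) :
    Measurable (reducedCampbell A) := by
  classical
  have key : ∀ R ∈ countRectangles X, Measurable fun ω => reducedCampbell A ω R := by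
    rintro _ ⟨B, l, hB, hl, rfl⟩
    have : (fun ω => reducedCampbell A ω (B ×ˢ {ω | ∀ p ∈ l, count p.1 ω = p.2})) =
        (count A ⁻¹' {⊤}ᶜ).indicator
          ({ω | ∀ p ∈ l, count p.1 ω = p.2 + if B ⊆ p.1 then 1 else 0}.indicator
            (fun ω => (count (A ∩ B) ω : ℝ≥0∞))) := by
      funext ω
      by_cases h : count A ω = ⊤
      · simp [reducedCampbell_of_eq_top h, h]
      · rw [reducedCampbell_rectangle h hB hl,
          indicator_of_mem (s := count A ⁻¹' {⊤}ᶜ) (by simpa using h)]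
    rw [this]
    refine Measurable.indicator (Measurable.indicator ?_ ?_) ?_
    · exact (measurable_from_top (f := fun n : ℕ∞ => (n : ℝ≥0∞))).comp
        (measurable_count (hA.inter hB))
    · exact measurableSet_forall_count_eq (fun p hp => (hl p hp).1) _
    · exact measurable_count hA (measurableSet_singleton _).compl
  refine Measurable.measure_of_isPiSystem generateFrom_countRectangles
    isPiSystem_countRectangles key (key _ ⟨univ, ∅, .univ, by simp, by ext; simp⟩)

end CountableConfig

/-! ### The Mecke formula. -/

namespace IsPoissonProcessLaw

variable {X : Type*} [MeasurableSpace X] {μ : Measure X} {P : Measure (CountableConfig X)}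

theorem ae_count_ne_top (hP : IsPoissonProcessLaw μ P) {D : Set X} (hD : MeasurableSet D)
    (hT : μ D ≠ ⊤) : ∀ᵐ ω ∂P, count D ω ≠ ⊤ := by
  have := hP.isProbabilityMeasure
  have hm : ∀ k : ℕ, MeasurableSet {ω | count D ω = k} := fun k =>
    measurable_count hD (measurableSet_singleton (k : ℕ∞))
  have h1 : P (⋃ k : ℕ, {ω | count D ω = k}) = 1 := by
    rw [measure_iUnion _ hm]
    · simp_rw [hP.count_of_ne_top D hD hT]
      rw [← ENNReal.ofReal_tsum_of_nonneg (fun k => by positivity)]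
      · have := (ProbabilityTheory.hasSum_one_poissonMeasure (μ D).toNNReal).tsum_eq
        rw [show (μ D).toReal = ((μ D).toNNReal : ℝ) from rfl, this, ENNReal.ofReal_one]
      · exact (ProbabilityTheory.hasSum_one_poissonMeasure (μ D).toNNReal).summable
    · intro i j hij
      refine disjoint_left.mpr fun ω hi hj => hij ?_
      exact_mod_cast hi.symm.trans hj
  filter_upwards [(mem_ae_iff_prob_eq_one (MeasurableSet.iUnion hm)).mpr h1] with ω hω
  obtain ⟨k, hk⟩ := mem_iUnion.mp hω
  rw [mem_ofPred_eq] at hk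
  simp [hk]

/-- The recursion of Poisson weights is the one-dimensional case of the Mecke formula. -/
theorem succ_mul_prob_count (hP : IsPoissonProcessLaw μ P) {D : Set X} (hD : MeasurableSet D)
    (hT : μ D ≠ ⊤) (k : ℕ) :
    ((k + 1 : ℕ) : ℝ≥0∞) * P {ω | count D ω = (k + 1 : ℕ)} = μ D * P {ω | count D ω = k} := by
  rw [hP.count_of_ne_top D hD hT, hP.count_of_ne_top D hD hT, ← ENNReal.ofReal_natCast,
    ← ENNReal.ofReal_mul (by positivity), ← ENNReal.ofReal_toReal hT, ENNReal.toReal_ofReal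
    (by positivity), ← ENNReal.ofReal_mul (by positivity), Nat.factorial_succ]
  congr 1
  push_cast
  field_simp
  ring

/-- Size-biasing a Poisson count shifts it by one, and the independent `V` is unaffected. The event
`S k` depends on `k` because a prescribed count may include the points of `D`. -/
theorem lintegral_count_indicator (hP : IsPoissonProcessLaw μ P) {D : Set X}
    (hD : MeasurableSet D) (hT : μ D ≠ ⊤) {β : Type*} [MeasurableSpace β]
    {V : CountableConfig X → β} (hV : Measurable V)
    (hind : ProbabilityTheory.IndepFun (count D) V P) {S : ℕ → Set β}
    (hS : ∀ k, MeasurableSet (S k)) :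
    ∫⁻ ω, {ω | ∃ k : ℕ, count D ω = (k + 1 : ℕ) ∧ V ω ∈ S k}.indicator
        (fun ω => (count D ω : ℝ≥0∞)) ω ∂P =
      μ D * P {ω | ∃ k : ℕ, count D ω = k ∧ V ω ∈ S k} := by
  have hm : ∀ j k : ℕ, MeasurableSet {ω | count D ω = j ∧ V ω ∈ S k} := fun j k =>
    (measurable_count hD (measurableSet_singleton (j : ℕ∞))).inter (hV (hS k))
  have hprod : ∀ j k : ℕ, P {ω | count D ω = j ∧ V ω ∈ S k} =
      P {ω | count D ω = j} * P (V ⁻¹' S k) := fun j k =>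
    hind.measure_inter_preimage_eq_mul _ _ (measurableSet_singleton (j : ℕ∞)) (hS k)
  have e1 : ∀ ω, {ω | ∃ k : ℕ, count D ω = (k + 1 : ℕ) ∧ V ω ∈ S k}.indicator
        (fun ω => (count D ω : ℝ≥0∞)) ω = ∑' k : ℕ,
      {ω | count D ω = (k + 1 : ℕ) ∧ V ω ∈ S k}.indicator
        (fun _ => ((k + 1 : ℕ) : ℝ≥0∞)) ω := by
    intro ω
    by_cases h : ω ∈ {ω | ∃ k : ℕ, count D ω = (k + 1 : ℕ) ∧ V ω ∈ S k}
    · obtain ⟨k, hk⟩ := id h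
      rw [tsum_eq_single k, indicator_of_mem h,
        indicator_of_mem (s := {ω | count D ω = (k + 1 : ℕ) ∧ V ω ∈ S k}) hk, hk.1]
      · simp
      · intro j hj
        refine indicator_of_notMem (s := {ω | count D ω = (j + 1 : ℕ) ∧ V ω ∈ S j})
          (fun h' => hj ?_) _
        have := h'.1.symm.trans hk.1
        have : j + 1 = k + 1 := by exact_mod_cast this
        omega
    · rw [indicator_of_notMem h]
      exact (ENNReal.tsum_eq_zero.mpr fun k =>
        indicator_of_notMem (s := {ω | count D ω = (k + 1 : ℕ) ∧ V ω ∈ S k})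
          (fun h' => h ⟨k, h'⟩) _).symm
  have e2 : {ω | ∃ k : ℕ, count D ω = k ∧ V ω ∈ S k} =
      ⋃ k : ℕ, {ω | count D ω = k ∧ V ω ∈ S k} := by ext; simp
  simp_rw [e1]
  rw [lintegral_tsum fun k => (measurable_const.indicator (hm _ _)).aemeasurable, e2,
    measure_iUnion _ (fun k => hm k k), ← ENNReal.tsum_mul_left]
  · refine tsum_congr fun k => ?_
    rw [lintegral_indicator_const (hm _ _), hprod, hprod, ← mul_assoc, ← mul_assoc,
      hP.succ_mul_prob_count hD hT]
  · intro i j hij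
    refine disjoint_left.mpr fun ω hi hj => hij ?_
    exact_mod_cast hi.1.symm.trans hj.1

/-- On a rectangle over `B`, put `D = A ∩ B`. Each prescribed count is that of the part outside `D`,
plus that of `D` when `B ⊆ p.1`. The former are independent of `count D`, so the shift by one for
`count D` gives the claim. -/
theorem bind_reducedCampbell (hP : IsPoissonProcessLaw μ P) {A : Set X} (hA : MeasurableSet A)
    (hT : μ A ≠ ⊤) : P.bind (reducedCampbell A) = (μ.restrict A).prod P := by
  classical
  have := hP.isProbabilityMeasure
  have : IsFiniteMeasure (μ.restrict A) := ⟨by simpa using lt_top_iff_ne_top.mpr hT⟩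
  have hm := measurable_reducedCampbell hA
  have key : ∀ R ∈ countRectangles X,
      (μ.restrict A).prod P R = P.bind (reducedCampbell A) R := by
    rintro _ ⟨B, l, hB, hl, rfl⟩
    have hE := measurableSet_forall_count_eq (fun p hp => (hl p hp).1) (fun p => (p.2 : ℕ∞))
    set D := A ∩ B with hDdef
    have hD : MeasurableSet D := hA.inter hB
    have hDT : μ D ≠ ⊤ := ne_top_of_le_ne_top hT (measure_mono inter_subset_left)
    let V : CountableConfig X → (l → ℕ∞) := fun ω p => count (p.1.1 \ D) ω
    have hdm : ∀ p : l, MeasurableSet (p.1.1 \ D) := fun p => (hl p.1 p.2).1.diff hD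
    have hV : Measurable V := measurable_pi_lambda _ fun p => measurable_count (hdm p)
    have hind : ProbabilityTheory.IndepFun (count D) V P :=
      hP.indepFun_count hD (fun p : l => p.1.1 \ D) hdm fun p => disjoint_sdiff_right
    -- Outside counts that reach the prescribed values once `k` points of `D` are included. Erasing
    -- one of `k + 1` points leaves `k`, so the same `S k` serves both sides.
    let S : ℕ → Set (l → ℕ∞) := fun k =>
      {v | ∀ p : l, v p + (if B ⊆ p.1.1 then (k : ℕ∞) else 0) = p.1.2}
    have hS : ∀ k, MeasurableSet (S k) := fun k => by
      have : S k = ⋂ p : l, {v | v p + (if B ⊆ p.1.1 then (k : ℕ∞) else 0) = p.1.2} := by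
        ext; simp [S]
      rw [this]
      exact MeasurableSet.iInter fun p =>
        ((measurable_from_top (f := fun n : ℕ∞ => n + (if B ⊆ p.1.1 then (k : ℕ∞) else 0))).comp
          (measurable_pi_apply p)) (measurableSet_singleton _)
    have hcount : ∀ ω, ∀ p ∈ l, count p.1 ω =
        count (p.1 \ D) ω + if B ⊆ p.1 then count D ω else 0 := by
      intro ω p hp
      split_ifs with hs
      · rw [← count_union disjoint_sdiff_left,
          sdiff_union_of_subset (inter_subset_right.trans hs)]
      · have hd := (hl p hp).2.resolve_left hs
        rw [(hd.mono_left inter_subset_right).sdiff_eq_right, add_zero]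
    have hsucc : ∀ ω, ∀ k : ℕ, count D ω = (k + 1 : ℕ) →
        ((∀ p ∈ l, count p.1 ω = p.2 + if B ⊆ p.1 then 1 else 0) ↔ V ω ∈ S k) := by
      intro ω k hk
      simp only [S, V, mem_ofPred_eq, Subtype.forall]
      refine forall₂_congr fun p hp => ?_
      rw [hcount ω p hp, hk]
      split_ifs
      · rw [Nat.cast_add, ← add_assoc, Nat.cast_one]
        exact (ENat.add_left_injective_of_ne_top (by simp)).eq_iff
      · rfl
    have hzero : ∀ ω, ∀ k : ℕ, count D ω = k →
        ((∀ p ∈ l, count p.1 ω = p.2) ↔ V ω ∈ S k) := by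
      intro ω k hk
      simp only [S, V, mem_ofPred_eq, Subtype.forall]
      refine forall₂_congr fun p hp => ?_
      rw [hcount ω p hp, hk]
    rw [Measure.prod_prod, Measure.restrict_apply hB, inter_comm B A,
      Measure.bind_apply (hB.prod hE) hm.aemeasurable]
    have hr : ∀ᵐ ω ∂P, reducedCampbell A ω (B ×ˢ {ω | ∀ p ∈ l, count p.1 ω = p.2}) =
        {ω | ∃ k : ℕ, count D ω = (k + 1 : ℕ) ∧ V ω ∈ S k}.indicator
        (fun ω => (count D ω : ℝ≥0∞)) ω := by
      filter_upwards [hP.ae_count_ne_top hA hT, hP.ae_count_ne_top hD hDT] with ω h h'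
      rw [reducedCampbell_rectangle h hB hl]
      obtain ⟨n, hn⟩ := ENat.ne_top_iff_exists.mp h'
      rcases n with _ | n
      · have h0 : count D ω = 0 := by simpa using hn.symm
        simp [indicator, h0, ← hDdef]
      · refine indicator_eq_indicator ?_ rfl
        rw [mem_ofPred_eq, hsucc ω n hn.symm]
        refine ⟨fun h => ⟨n, hn.symm, h⟩, ?_⟩
        rintro ⟨k, hk, hkS⟩
        have : n + 1 = k + 1 := by exact_mod_cast hn.trans hk
        obtain rfl : n = k := by omega
        exact hkS
    rw [lintegral_congr_ae hr, hP.lintegral_count_indicator hD hDT hV hind hS]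
    congr 1
    refine measure_congr ?_
    filter_upwards [hP.ae_count_ne_top hD hDT] with ω h'
    obtain ⟨n, hn⟩ := ENat.ne_top_iff_exists.mp h'
    refine propext ?_
    change (∀ p ∈ l, count p.1 ω = p.2) ↔ ∃ k : ℕ, count D ω = k ∧ V ω ∈ S k
    rw [hzero ω n hn.symm]
    refine ⟨fun h => ⟨n, hn.symm, h⟩, ?_⟩
    rintro ⟨k, hk, hkS⟩
    obtain rfl : n = k := by exact_mod_cast hn.trans hk
    exact hkS
  refine (ext_of_generate_finite _ generateFrom_countRectangles isPiSystem_countRectangles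
    key ?_).symm
  exact key _ ⟨univ, ∅, .univ, by simp, by ext; simp⟩

/-- The reduced Campbell formula, `𝔼 ∑_{x ∈ ω} F (x, ω \ {x}) = ∫∫ F dμ dP`. -/
theorem aemeasurable_tsum_and_lintegral_tsum_eq (hP : IsPoissonProcessLaw μ P) [SigmaFinite μ]
    {F : X × CountableConfig X → ℝ≥0∞} (hF : Measurable F) :
    AEMeasurable (fun ω => ∑' x : ω.carrier, F (x.1, erasePoint x.1 ω)) P ∧
    ∫⁻ ω, ∑' x : ω.carrier, F (x.1, erasePoint x.1 ω) ∂P = ∫⁻ z, F z ∂(μ.prod P) := by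
  have := hP.isProbabilityMeasure
  -- Disjoint pieces of finite measure, so that every point of `ω` is summed exactly once.
  let T : ℕ → Set X := disjointed (spanningSets μ)
  have hTm : ∀ n, MeasurableSet (T n) := MeasurableSet.disjointed (measurableSet_spanningSets μ)
  have hTt : ∀ n, μ (T n) ≠ ⊤ := fun n => ne_top_of_le_ne_top
    (measure_spanningSets_lt_top μ n).ne (measure_mono (disjointed_subset _ _))
  have hTu : ⋃ n, T n = univ := by rw [iUnion_disjointed, iUnion_spanningSets]
  have hTd : Pairwise (Function.onFun Disjoint T) := disjoint_disjointed _
  have hsplit : ∀ᵐ ω ∂P, ∑' x : ω.carrier, F (x.1, erasePoint x.1 ω) =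
      ∑' n, ∫⁻ z, F z ∂(reducedCampbell (T n) ω) := by
    filter_upwards [ae_all_iff.mpr fun n => hP.ae_count_ne_top (hTm n) (hTt n)] with ω hω
    have e : ω.carrier = ⋃ n, ω.carrier ∩ T n := by rw [← inter_iUnion, hTu, inter_univ]
    simp_rw [fun n => lintegral_reducedCampbell (hω n) hF]
    rw [tsum_congr_set_coe (fun x => F (x, erasePoint x ω)) e]
    exact ENNReal.tsum_biUnion (f := fun x => F (x, erasePoint x ω)) fun i _ j _ h =>
      (hTd h).mono inter_subset_right inter_subset_right
  have hmeas : ∀ n, Measurable fun ω => ∫⁻ z, F z ∂(reducedCampbell (T n) ω) := fun n =>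
    (Measure.measurable_lintegral hF).comp (measurable_reducedCampbell (hTm n))
  refine ⟨⟨_, Measurable.tsum hmeas, hsplit⟩, ?_⟩
  rw [lintegral_congr_ae hsplit, lintegral_tsum fun n => (hmeas n).aemeasurable]
  have hbind : ∀ n, ∫⁻ ω, ∫⁻ z, F z ∂(reducedCampbell (T n) ω) ∂P =
      ∫⁻ z, F z ∂((μ.restrict (T n)).prod P) := fun n => by
    rw [← hP.bind_reducedCampbell (hTm n) (hTt n),
      Measure.lintegral_bind (measurable_reducedCampbell (hTm n)).aemeasurable hF.aemeasurable]
  simp_rw [hbind]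
  rw [← lintegral_sum_measure, ← Measure.prod_sum_left, ← Measure.restrict_iUnion hTd hTm, hTu,
    Measure.restrict_univ]

/-- By the Mecke formula, the expected number of points of `ω` falling in a null set of pairs is
`0`. -/
theorem ae_forall_mem_erasePoint (hP : IsPoissonProcessLaw μ P) [SigmaFinite μ]
    {p : X × CountableConfig X → Prop} (hp : ∀ᵐ z ∂(μ.prod P), p z) :
    ∀ᵐ ω ∂P, ∀ x ∈ ω.carrier, p (x, erasePoint x ω) := by
  set N := toMeasurable (μ.prod P) {z | ¬ p z}
  have hN : MeasurableSet N := measurableSet_toMeasurable _ _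
  have h0 : μ.prod P N = 0 := by rw [measure_toMeasurable]; exact hp
  obtain ⟨h1, h2⟩ := hP.aemeasurable_tsum_and_lintegral_tsum_eq
    (F := N.indicator 1) (measurable_one.indicator hN)
  rw [lintegral_indicator_one hN, h0, lintegral_eq_zero_iff' h1] at h2
  filter_upwards [h2] with ω hω x hx
  by_contra h
  have := ENNReal.tsum_eq_zero.mp hω ⟨x, hx⟩
  rw [indicator_of_mem (subset_toMeasurable _ _ h)] at this
  simp at this

end IsPoissonProcessLaw

/-! ### Adding a point to a Poisson configuration. -/

namespace IsPoissonProcessLaw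

variable {X : Type*} [MeasurableSpace X] {μ : Measure X} {P : Measure (CountableConfig X)}

/-- A fixed `x` is not an atom, so it has neighbourhoods of arbitrarily small measure inside a
spanning set, and these contain points of `ω` with arbitrarily small probability. -/
theorem ae_prod_notMem [StandardBorelSpace X] [SigmaFinite μ] [NullSingletonClass μ]
    (hP : IsPoissonProcessLaw μ P) :
    ∀ᵐ z ∂(μ.prod P), z.1 ∉ z.2.carrier := by
  have := hP.isProbabilityMeasure
  let _ := upgradeStandardBorel X
  let b := TopologicalSpace.countableBasis X
  -- A measurable set of pairs with `x ∉ ω`, witnessed by an empty basic neighbourhood cut down to a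
  -- spanning set.
  let N : Set (X × CountableConfig X) := ⋃ U ∈ b, ⋃ n : ℕ,
    (U ∩ spanningSets μ n) ×ˢ {ω | count (U ∩ spanningSets μ n) ω = 0}
  have hbm : ∀ U ∈ b, MeasurableSet U := fun U hU =>
    ((TopologicalSpace.isBasis_countableBasis X).isOpen hU).measurableSet
  have hD : ∀ U ∈ b, ∀ n, MeasurableSet (U ∩ spanningSets μ n) := fun U hU n =>
    (hbm U hU).inter (measurableSet_spanningSets μ n)
  have hN : MeasurableSet N :=
    MeasurableSet.biUnion (TopologicalSpace.countable_countableBasis X) fun U hU =>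
      MeasurableSet.iUnion fun n => (hD U hU n).prod
        (measurable_count (hD U hU n) (measurableSet_singleton 0))
  have hae : ∀ᵐ z ∂(μ.prod P), z ∈ N := by
    refine (Measure.ae_prod_iff_ae_ae hN).mpr (Eventually.of_forall fun x => ?_)
    rw [ae_iff]
    refine le_antisymm (ENNReal.le_of_forall_pos_le_add fun ε hε _ => ?_) zero_le
    obtain ⟨n, hn⟩ := mem_iUnion.mp (iUnion_spanningSets μ ▸ mem_univ x)
    -- Outer regularity is applied to this finite restriction, since `μ` need not be locally finite.
    have : IsFiniteMeasure (μ.restrict (spanningSets μ n)) :=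
      ⟨by simpa using measure_spanningSets_lt_top μ n⟩
    obtain ⟨V, hV, hVo, hVε⟩ := ({x} : Set X).exists_isOpen_lt_of_lt
      (μ := μ.restrict (spanningSets μ n)) ε (by simpa using hε)
    obtain ⟨U, hU, hxU, hUV⟩ := (TopologicalSpace.isBasis_countableBasis X).exists_subset_of_mem_open
      (singleton_subset_iff.mp hV) hVo
    rw [zero_add]
    refine le_trans ?_ (((hP.prob_count_ne_zero_le (hD U hU n)).trans ?_).trans hVε.le)
    · refine measure_mono fun ω hω h0 => hω ?_
      exact mem_biUnion hU (mem_iUnion.mpr ⟨n, ⟨hxU, hn⟩, h0⟩)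
    · rw [Measure.restrict_apply hVo.measurableSet]
      exact measure_mono (inter_subset_inter_left _ hUV)
  filter_upwards [hae] with z hz hmem
  simp only [N, mem_iUnion, mem_prod] at hz
  obtain ⟨U, -, n, hx, h0⟩ := hz
  exact count_eq_zero.mp h0 _ hmem hx

/-- Off the null set where `x ∈ ω` already, every count grows by the indicator of `x ∈ B`, which is
measurable. -/
theorem aemeasurable_addPoint [StandardBorelSpace X] [SigmaFinite μ] [NullSingletonClass μ]
    (hP : IsPoissonProcessLaw μ P) :
    AEMeasurable (fun z : X × CountableConfig X => addPoint z.1 z.2) (μ.prod P) := by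
  classical
  set N := toMeasurable (μ.prod P) {z : X × CountableConfig X | ¬ z.1 ∉ z.2.carrier}
  have hN : MeasurableSet N := measurableSet_toMeasurable _ _
  refine ⟨fun z => if z ∈ N then z.2 else addPoint z.1 z.2, ?_, ?_⟩
  · refine measurable_of_measurable_count fun B hB => ?_
    have : (fun z : X × CountableConfig X => count B (if z ∈ N then z.2 else addPoint z.1 z.2)) =
        fun z => if z ∈ N then count B z.2 else count B z.2 + B.indicator 1 z.1 := by
      funext z
      split_ifs with h
      · rfl
      · rw [count_addPoint (fun h' => h (subset_toMeasurable _ _ (not_not.mpr h')))]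
        simp [indicator]
    rw [this]
    have hc : Measurable fun z : X × CountableConfig X => count B z.2 :=
      (measurable_count hB).comp measurable_snd
    have hi : Measurable fun z : X × CountableConfig X => B.indicator (1 : X → ℕ∞) z.1 :=
      (measurable_one.indicator hB).comp measurable_fst
    exact Measurable.ite hN hc (hc.add hi)
  · have h0 : μ.prod P N = 0 := by
      rw [measure_toMeasurable]; exact hP.ae_prod_notMem
    filter_upwards [measure_eq_zero_iff_ae_notMem.mp h0] with z hz
    rw [if_neg hz]

/-- A property of almost every `ω` and all `x ∈ ω` holds for almost every pair `(x, {x} ∪ ω)`. -/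
theorem ae_addPoint [StandardBorelSpace X] [SigmaFinite μ] [NullSingletonClass μ]
    (hP : IsPoissonProcessLaw μ P) {p : CountableConfig X → Prop} (hp : ∀ᵐ ω ∂P, p ω) :
    ∀ᵐ z ∂(μ.prod P), p (addPoint z.1 z.2) := by
  have := hP.isProbabilityMeasure
  obtain ⟨g, hg, hge⟩ := hP.aemeasurable_addPoint
  set N := toMeasurable P {ω | ¬ p ω}
  have hN : MeasurableSet N := measurableSet_toMeasurable _ _
  have h0 : P N = 0 := by rw [measure_toMeasurable]; exact hp
  have h1 : ∀ᵐ ω ∂P, ∑' x : ω.carrier,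
      (g ⁻¹' N).indicator (1 : X × CountableConfig X → ℝ≥0∞) (x.1, erasePoint x.1 ω) = 0 := by
    filter_upwards [measure_eq_zero_iff_ae_notMem.mp h0, hP.ae_forall_mem_erasePoint hge]
      with ω hω hω'
    refine ENNReal.tsum_eq_zero.mpr fun x => indicator_of_notMem ?_ _
    rw [mem_preimage, ← hω' x x.2, addPoint_erasePoint x.2]
    exact hω
  have h2 := (hP.aemeasurable_tsum_and_lintegral_tsum_eq
    (F := (g ⁻¹' N).indicator 1) (measurable_one.indicator (hg hN))).2
  rw [lintegral_congr_ae h1, lintegral_zero, lintegral_indicator_one (hg hN)] at h2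
  filter_upwards [measure_eq_zero_iff_ae_notMem.mp h2.symm, hge] with z hz hz'
  by_contra h
  exact hz (hz' ▸ subset_toMeasurable _ _ h : g z ∈ N)

end IsPoissonProcessLaw

theorem IsPoissonAllocation.isAEPoissonAllocation {X : Type*} [MeasurableSpace X]
    [StandardBorelSpace X] {μ : Measure X} [SigmaFinite μ] [NullSingletonClass μ]
    {P : Measure (CountableConfig X)} (hP : IsPoissonProcessLaw μ P)
    {Υ : X × CountableConfig X → Lp ℝ 1 μ} (h : IsPoissonAllocation μ P Υ) :
    IsAEPoissonAllocation μ P Υ where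
  aemeasurable := h.measurable.aestronglyMeasurable.comp_aemeasurable
    (measurable_fst.aemeasurable.prodMk hP.aemeasurable_addPoint)
  nonneg := Eventually.of_forall fun ω x _ => h.nonneg x ω
  partition_of_unity := h.partition_of_unity

/-! ### The zero-infinity dichotomy for balls. -/

/-- If the action preserves the distances between the values of `f` up to null sets, and its
extension by the Poisson process is ergodic, then the balls around the values of `f` have preimages
of measure `0` almost everywhere, or of measure `∞` almost everywhere. -/
theorem ae_measure_ball_eq_zero_or_top {G Z E : Type*} [Group G] [MulAction G Z]
    [MeasurableSpace Z] [MeasurableConstSMul G Z]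
    [PseudoMetricSpace E] [SecondCountableTopology E] [MeasurableSpace E] [BorelSpace E]
    {ν : Measure Z} [SFinite ν] {Q : Measure (CountableConfig Z)} (hQ : IsPoissonProcessLaw ν Q)
    [ErgodicSMul G (Z × CountableConfig Z) (ν.prod Q)]
    {f : Z → E} (hf : Measurable f)
    (hfg : ∀ g : G, ∀ᵐ z ∂ν, ∀ᵐ z' ∂ν, dist (f (g • z)) (f (g • z')) = dist (f z) (f z')) (ε : ℝ) :
    (∀ᵐ z ∂ν, ν (f ⁻¹' Metric.ball (f z) ε) = 0) ∨
      ∀ᵐ z ∂ν, ν (f ⁻¹' Metric.ball (f z) ε) = ⊤ := by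
  have := hQ.isProbabilityMeasure
  obtain ⟨D, hDc, hDd⟩ := TopologicalSpace.exists_countable_dense E
  have hbm : ∀ u r, MeasurableSet (f ⁻¹' Metric.ball u r) := fun u r =>
    hf Metric.isOpen_ball.measurableSet
  let S : Set (Z × CountableConfig Z) := {w | count (f ⁻¹' Metric.ball (f w.1) ε) w.2 = 0}
  have hS : MeasurableSet S := by
    -- Balls with moving centre `f z` are exhausted by countably many fixed balls with centre in `D`
    -- and rational radius, so `S` is a countable intersection of unions of product sets.
    have e : S = ⋂ d ∈ D, ⋂ q : ℚ, ({z | dist (f z) d + q < ε}ᶜ ×ˢ univ) ∪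
        (univ ×ˢ {Ω | count (f ⁻¹' Metric.ball d q) Ω = 0}) := by
      ext ⟨z, Ω⟩
      simp only [S, mem_ofPred_eq, mem_iInter, mem_union, mem_prod, mem_univ, and_true, true_and,
        mem_compl_iff, ← imp_iff_not_or, count_eq_zero, mem_preimage, Metric.mem_ball]
      refine ⟨fun h d _ q hq z' hz' hd => h z' hz' ?_, fun h z' hz' hd => ?_⟩
      · linarith [dist_triangle_right (f z') (f z) d]
      · obtain ⟨d, hdD, hd'⟩ := hDd.exists_dist_lt (f z')
          (show 0 < (ε - dist (f z') (f z)) / 2 by linarith)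
        obtain ⟨q, hq1, hq2⟩ := exists_rat_btwn hd'
        refine h d hdD q ?_ z' hz' hq1
        linarith [dist_triangle_left (f z) d (f z'), dist_comm (f z) (f z')]
    rw [e]
    refine MeasurableSet.biInter hDc fun d _ => MeasurableSet.iInter fun q => ?_
    refine MeasurableSet.union (MeasurableSet.prod ?_ .univ) (MeasurableSet.univ.prod ?_)
    · exact (measurableSet_lt ((hf.dist measurable_const).add_const _) measurable_const).compl
    · exact measurable_count (hbm _ _) (measurableSet_singleton 0)
  have hinv : ∀ g : G, (g • ·) ⁻¹' S =ᵐ[ν.prod Q] S := by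
    intro g
    have hgS : MeasurableSet ((g • ·) ⁻¹' S) :=
      (((measurable_const_smul g).comp measurable_fst).prodMk
        ((measurable_const_smul g).comp measurable_snd)) hS
    have hm : MeasurableSet {w | w ∈ (g • ·) ⁻¹' S ↔ w ∈ S} := by
      convert (hgS.inter hS).union (hgS.compl.inter hS.compl) using 1
      ext w
      simp only [mem_ofPred_eq, mem_union, mem_inter_iff, mem_compl_iff]
      tauto
    suffices h : ∀ᵐ w ∂(ν.prod Q), w ∈ (g • ·) ⁻¹' S ↔ w ∈ S from
      h.mono fun w hw => propext hw
    refine (Measure.ae_prod_iff_ae_ae hm).mpr ?_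
    filter_upwards [hfg g] with z hz
    -- For fixed `z` the distance identity fails only on a null set of `z'`, which the process
    -- almost surely avoids.
    filter_upwards [hQ.ae_forall_mem hz] with Ω hΩ
    change count (f ⁻¹' Metric.ball (f (g • z)) ε) (g • Ω) = 0 ↔
      count (f ⁻¹' Metric.ball (f z) ε) Ω = 0
    rw [count_smul, count_eq_zero, count_eq_zero]
    refine forall₂_congr fun z' hz' => ?_
    simp only [mem_preimage, Metric.mem_ball, dist_comm _ (f (g • z)), hΩ z' hz', dist_comm _ (f z)]
  have hc := ErgodicSMul.aeconst_of_forall_preimage_smul_ae_eq hS hinv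
  rcases eventuallyConst_set.mp hc with h | h
  · left
    filter_upwards [Measure.ae_ae_of_ae_prod h] with z hz
    exact hQ.measure_eq_zero (hbm _ _) hz
  · right
    filter_upwards [Measure.ae_ae_of_ae_prod h] with z hz
    exact hQ.measure_eq_top (hbm _ _) hz

/-- By second countability, the centres of `ε`-balls that are null for the image measure form a
locally null, hence null, set. The first alternative would then force `ν = 0`. -/
theorem ae_measure_ball_eq_top {Z E : Type*} [MeasurableSpace Z]
    [PseudoMetricSpace E] [SecondCountableTopology E] [MeasurableSpace E] [BorelSpace E]
    {ν : Measure Z} {f : Z → E} (hf : Measurable f) (hν : ν ≠ 0) {ε : ℝ} (hε : 0 < ε)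
    (h : (∀ᵐ z ∂ν, ν (f ⁻¹' Metric.ball (f z) ε) = 0) ∨
      ∀ᵐ z ∂ν, ν (f ⁻¹' Metric.ball (f z) ε) = ⊤) :
    ∀ᵐ z ∂ν, ν (f ⁻¹' Metric.ball (f z) ε) = ⊤ := by
  refine h.resolve_left fun h0 => hν ?_
  have hnull : ν.map f {u | ν.map f (Metric.ball u ε) = 0} = 0 :=
    measure_null_of_locally_null _ fun u hu =>
      ⟨_, mem_nhdsWithin_of_mem_nhds (Metric.ball_mem_nhds u hε), hu⟩
  have hnull' := ae_of_ae_map hf.aemeasurable (measure_eq_zero_iff_ae_notMem.mp hnull)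
  rw [← ae_eq_bot, ← empty_mem_iff_bot]
  filter_upwards [h0, hnull'] with z hz hz'
  refine hz' ?_
  rw [Measure.map_apply hf Metric.isOpen_ball.measurableSet]
  exact hz

/-! ### Local mass and distances in `L¹`. -/

section Lp

variable {X : Type*} [MeasurableSpace X] {μ : Measure X}

/-- The mass in `B` is 1-Lipschitz on `L¹`; this gives its measurability and its lower bound on
small balls. -/
theorem setLIntegral_enorm_le_add_edist (B : Set X) (u v : Lp ℝ 1 μ) :
    ∫⁻ y in B, ‖u y‖ₑ ∂μ ≤ ∫⁻ y in B, ‖v y‖ₑ ∂μ + edist u v := by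
  have h : ∀ᵐ y ∂(μ.restrict B), ‖u y‖ₑ ≤ ‖v y‖ₑ + ‖u y - v y‖ₑ :=
    Eventually.of_forall fun y => by
      simpa using enorm_add_le (v y) (u y - v y)
  refine (lintegral_mono_ae h).trans ?_
  rw [lintegral_add_left' (Lp.aestronglyMeasurable v).restrict.enorm]
  gcongr
  refine (setLIntegral_le_lintegral _ _).trans_eq ?_
  rw [Lp.edist_def, eLpNorm_one_eq_lintegral_enorm]
  rfl

theorem measurable_setLIntegral_enorm [MeasurableSpace (Lp ℝ 1 μ)] [BorelSpace (Lp ℝ 1 μ)]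
    (B : Set X) : Measurable fun u : Lp ℝ 1 μ => ∫⁻ y in B, ‖u y‖ₑ ∂μ :=
  (continuous_of_le_add_edist 1 ENNReal.one_ne_top fun u v => by
    simpa using setLIntegral_enorm_le_add_edist B u v).measurable

theorem setLIntegral_enorm_ne_top (B : Set X) (u : Lp ℝ 1 μ) : ∫⁻ y in B, ‖u y‖ₑ ∂μ ≠ ⊤ := by
  have := Lp.eLpNorm_ne_top u
  rw [eLpNorm_one_eq_lintegral_enorm] at this
  exact ne_top_of_le_ne_top this (setLIntegral_le_lintegral _ _)

theorem exists_setLIntegral_enorm_ne_zero [SigmaFinite μ] {u : Lp ℝ 1 μ} (hu : u ≠ 0) :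
    ∃ n, ∫⁻ y in spanningSets μ n, ‖u y‖ₑ ∂μ ≠ 0 := by
  by_contra! h
  refine hu (Lp.eq_zero_iff_ae_eq_zero.mpr ?_)
  have h' : ∀ᵐ y ∂(μ.restrict (⋃ n, spanningSets μ n)), u y = 0 := by
    refine (ae_restrict_iUnion_iff _ _).mpr fun n => ?_
    filter_upwards [(lintegral_eq_zero_iff' (Lp.aestronglyMeasurable u).restrict.enorm).mp (h n)]
      with y hy
    simpa using hy
  rw [iUnion_spanningSets, Measure.restrict_univ] at h'
  exact h'

/-- Composition with a measure-preserving map is an isometry of `L¹`. -/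
theorem dist_eq_of_comp_ae_eq {T : X → X} (hT : MeasurePreserving T μ μ) {u v u' v' : Lp ℝ 1 μ}
    (hu : (fun y => u (T y)) =ᵐ[μ] u') (hv : (fun y => v (T y)) =ᵐ[μ] v') :
    dist u v = dist u' v' := by
  have h : ∀ {w w' : Lp ℝ 1 μ}, (fun y => w (T y)) =ᵐ[μ] w' →
      Lp.compMeasurePreserving T hT w = w' := fun hw =>
    Lp.ext ((Lp.coeFn_compMeasurePreserving _ hT).trans hw)
  rw [← h hu, ← h hv, (Lp.isometry_compMeasurePreserving hT).dist_eq]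

end Lp

/-! ### Mass conservation and equivariance of the modified allocation. -/

section Allocation

variable {X : Type*} [MeasurableSpace X] {μ : Measure X} {P : Measure (CountableConfig X)}
  {Υ : X × CountableConfig X → Lp ℝ 1 μ} {f : X × CountableConfig X → Lp ℝ 1 μ}

theorem IsAEPoissonAllocation.ae_tsum_setLIntegral_enorm (hΥ : IsAEPoissonAllocation μ P Υ)
    (B : Set X) :
    ∀ᵐ ω ∂P, ∑' x : ω.carrier, ∫⁻ y in B, ‖Υ (x.1, ω) y‖ₑ ∂μ = μ B := by
  filter_upwards [hΥ.nonneg, hΥ.partition_of_unity] with ω h0 h1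
  have := ω.countable.to_subtype
  have h0' : ∀ᵐ y ∂μ, ∀ x : ω.carrier, 0 ≤ Υ (x.1, ω) y := ae_all_iff.mpr fun x =>
    (Lp.coeFn_nonneg _).mpr (h0 x x.2)
  rw [← lintegral_tsum fun x => (Lp.aestronglyMeasurable _).restrict.enorm, ← setLIntegral_one]
  refine lintegral_congr_ae (ae_restrict_of_ae ?_)
  filter_upwards [h0', h1] with y hy hy1
  simp_rw [fun x : ω.carrier => Real.enorm_of_nonneg (hy x)]
  rw [← ENNReal.ofReal_tsum_of_nonneg hy hy1.summable, hy1.tsum_eq, ENNReal.ofReal_one]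

theorem IsPoissonProcessLaw.ae_forall_mem_eq_modification [SigmaFinite μ]
    (hP : IsPoissonProcessLaw μ P)
    (hf : (fun z => Υ (z.1, addPoint z.1 z.2)) =ᵐ[μ.prod P] f) :
    ∀ᵐ ω ∂P, ∀ x ∈ ω.carrier, f (x, erasePoint x ω) = Υ (x, ω) := by
  filter_upwards [hP.ae_forall_mem_erasePoint hf] with ω hω x hx
  rw [← hω x hx, addPoint_erasePoint hx]

/-- The Mecke formula rewrites the left side as the expected mass in `B` allocated to the points of
`ω`, and almost surely that mass is `μ B`. -/
theorem IsAEPoissonAllocation.lintegral_setLIntegral_enorm [SigmaFinite μ]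
    (hΥ : IsAEPoissonAllocation μ P Υ) (hP : IsPoissonProcessLaw μ P)
    (hf : (fun z => Υ (z.1, addPoint z.1 z.2)) =ᵐ[μ.prod P] f)
    (hfm : StronglyMeasurable f) (B : Set X) :
    ∫⁻ z, ∫⁻ y in B, ‖f z y‖ₑ ∂μ ∂(μ.prod P) = μ B := by
  have := hP.isProbabilityMeasure
  let _ : MeasurableSpace (Lp ℝ 1 μ) := borel _
  have : BorelSpace (Lp ℝ 1 μ) := ⟨rfl⟩
  refine (hP.aemeasurable_tsum_and_lintegral_tsum_eq
    ((measurable_setLIntegral_enorm B).comp hfm.measurable)).2.symm.trans ?_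
  have : ∀ᵐ ω ∂P, ∑' x : ω.carrier,
      ((fun u : Lp ℝ 1 μ => ∫⁻ y in B, ‖u y‖ₑ ∂μ) ∘ f) (x.1, erasePoint x.1 ω) = μ B := by
    filter_upwards [hP.ae_forall_mem_eq_modification hf, hΥ.ae_tsum_setLIntegral_enorm B]
      with ω h1 h2
    rw [← h2]
    exact tsum_congr fun x => by rw [Function.comp_apply, h1 x x.2]
  rw [lintegral_congr_ae this]
  simp

theorem IsEquivariantAllocation.ae_modification {G : Type*} [Group G] [MulAction G X]
    [StandardBorelSpace X] [SigmaFinite μ] [NullSingletonClass μ] [MeasurableConstSMul G X]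
    [SMulInvariantMeasure G (X × CountableConfig X) (μ.prod P)]
    (hΥ : IsEquivariantAllocation G μ P Υ) (hP : IsPoissonProcessLaw μ P)
    (hf : (fun z => Υ (z.1, addPoint z.1 z.2)) =ᵐ[μ.prod P] f) (g : G) :
    ∀ᵐ z ∂(μ.prod P), (fun y => f (g • z) (g • y)) =ᵐ[μ] f z := by
  have : MeasurableConstSMul G (X × CountableConfig X) :=
    ⟨fun g => ((measurable_const_smul g).comp measurable_fst).prodMk
      ((measurable_const_smul g).comp measurable_snd)⟩
  filter_upwards [hf, (measurePreserving_smul g (μ.prod P)).quasiMeasurePreserving.ae hf,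
    hP.ae_addPoint (hΥ g)] with z h1 h2 h3
  have h := h3 z.1 (mem_insert _ _)
  rw [smul_addPoint, h1] at h
  rw [← h2]
  exact h

end Allocation

/-! ### The contradiction. -/

theorem smulInvariantMeasure_of_prod {G Y Z : Type*} [Group G] [MulAction G Y] [MulAction G Z]
    [MeasurableSpace Y] [MeasurableSpace Z] {ν : Measure Y} {Q : Measure Z}
    [IsProbabilityMeasure Q] [SMulInvariantMeasure G (Y × Z) (ν.prod Q)] :
    SMulInvariantMeasure G Y ν where
  measure_preimage_smul g s hs := by
    have h := measure_preimage_smul_of_nullMeasurableSet (μ := ν.prod Q)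
      (hs.prod .univ).nullMeasurableSet g
    have e : (g • ·) ⁻¹' (s ×ˢ (univ : Set Z)) = ((g • ·) ⁻¹' s) ×ˢ univ := by
      ext; simp
    simpa [e] using h

theorem IsEquivariantAllocation.not_isAEPoissonAllocation {G X : Type*} [Group G] [MulAction G X]
    [MeasurableSpace X] [StandardBorelSpace X] [MeasurableConstSMul G X]
    {μ : Measure X} [SigmaFinite μ] [NullSingletonClass μ] [SMulInvariantMeasure G X μ]
    (hμ : μ ≠ 0) {P : Measure (CountableConfig X)} (hP : IsPoissonProcessLaw μ P)
    {Q : Measure (CountableConfig (X × CountableConfig X))}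
    (hQ : IsPoissonProcessLaw (μ.prod P) Q)
    (hErg : ErgodicSMul G
      ((X × CountableConfig X) × CountableConfig (X × CountableConfig X)) ((μ.prod P).prod Q))
    {Υ : X × CountableConfig X → Lp ℝ 1 μ} (hΥ : IsAEPoissonAllocation μ P Υ)
    (hG : IsEquivariantAllocation G μ P Υ) : False := by
  have := hP.isProbabilityMeasure
  have := hQ.isProbabilityMeasure
  have : MeasurableConstSMul G (X × CountableConfig X) :=
    ⟨fun g => ((measurable_const_smul g).comp measurable_fst).prodMk
      ((measurable_const_smul g).comp measurable_snd)⟩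
  have : SMulInvariantMeasure G (X × CountableConfig X) (μ.prod P) :=
    smulInvariantMeasure_of_prod (Q := Q)
  let _ : MeasurableSpace (Lp ℝ 1 μ) := borel _
  have : BorelSpace (Lp ℝ 1 μ) := ⟨rfl⟩
  have : Fact ((1 : ℝ≥0∞) ≠ ⊤) := ⟨ENNReal.one_ne_top⟩
  obtain ⟨f, hfs, hf⟩ := hΥ.aemeasurable
  have hfm : Measurable f := hfs.measurable
  have hν : μ.prod P ≠ 0 := fun h => hμ <| by
    rw [← Measure.measure_univ_eq_zero]
    simpa [← univ_prod_univ] using congrArg (fun m => m univ) h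
  have hdist : ∀ g : G, ∀ᵐ z ∂(μ.prod P), ∀ᵐ z' ∂(μ.prod P),
      dist (f (g • z)) (f (g • z')) = dist (f z) (f z') := by
    intro g
    have h := hG.ae_modification hP hf g
    filter_upwards [h] with z hz
    filter_upwards [h] with z' hz'
    exact dist_eq_of_comp_ae_eq (measurePreserving_smul g μ) hz hz'
  have htop : ∀ᵐ z ∂(μ.prod P), ∀ n : ℕ,
      μ.prod P (f ⁻¹' Metric.ball (f z) (1 / (n + 1))) = ⊤ := ae_all_iff.mpr fun n =>
    ae_measure_ball_eq_top hfm hν Nat.one_div_pos_of_nat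
      (ae_measure_ball_eq_zero_or_top hQ hfm hdist _)
  -- If `f` vanished a.e., almost surely no point of `ω` would receive any mass, although the total
  -- mass is `μ univ`.
  have hne : ∃ᵐ z ∂(μ.prod P), f z ≠ 0 := by
    intro h
    simp only [not_not] at h
    obtain ⟨ω, h1, h2, h3⟩ := ((hP.ae_forall_mem_erasePoint h).and
      ((hP.ae_forall_mem_eq_modification hf).and
        (hΥ.ae_tsum_setLIntegral_enorm univ))).exists
    refine hμ (Measure.measure_univ_eq_zero.mp (h3.symm.trans ?_))
    refine ENNReal.tsum_eq_zero.mpr fun x => ?_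
    rw [← h2 x x.2, h1 x x.2, Measure.restrict_univ, ← eLpNorm_one_eq_lintegral_enorm,
      eLpNorm_congr_ae (Lp.coeFn_zero ℝ 1 μ), eLpNorm_zero]
  obtain ⟨z, hz0, hz⟩ := (hne.and_eventually htop).exists
  obtain ⟨n, hn⟩ := exists_setLIntegral_enorm_ne_zero hz0
  set B := spanningSets μ n
  -- With half the mass of `f z` in `B` as radius bound, a value closer than `c` to `f z` retains
  -- mass at least `c` in `B`.
  set c := (∫⁻ y in B, ‖f z y‖ₑ ∂μ) / 2 with hc
  have hc0 : c ≠ 0 := (ENNReal.half_pos hn).ne'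
  have hct : c ≠ ⊤ := ENNReal.div_ne_top (setLIntegral_enorm_ne_top B (f z)) two_ne_zero
  obtain ⟨k, hk⟩ := exists_nat_one_div_lt (ENNReal.toReal_pos hc0 hct)
  have hsub : f ⁻¹' Metric.ball (f z) (1 / (k + 1)) ⊆
      {z' | c ≤ ∫⁻ y in B, ‖f z' y‖ₑ ∂μ} := by
    intro z' hz'
    have hd : edist (f z) (f z') ≤ c := by
      rw [edist_dist, dist_comm]
      exact ENNReal.ofReal_le_of_le_toReal ((Metric.mem_ball.mp hz').trans hk).le
    have h := (setLIntegral_enorm_le_add_edist B (f z) (f z')).trans (add_le_add_right hd _)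
    rw [← ENNReal.add_halves (∫⁻ y in B, ‖f z y‖ₑ ∂μ)] at h
    exact (ENNReal.add_le_add_iff_right hct).mp h
  -- Markov's inequality: `c` times an infinite measure is at most `μ B`.
  have hle := mul_meas_ge_le_lintegral (μ := μ.prod P)
    ((measurable_setLIntegral_enorm B).comp hfm) c
  have hinf : μ.prod P {z' | c ≤ ∫⁻ y in B, ‖f z' y‖ₑ ∂μ} = ⊤ :=
    top_unique ((hz k).ge.trans (measure_mono hsub))
  have hB := hΥ.lintegral_setLIntegral_enorm hP hf hfs B
  simp only [Function.comp_apply] at hle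
  rw [hinf, hB, ENNReal.mul_top hc0] at hle
  exact (measure_spanningSets_lt_top μ n).not_ge hle

theorem mainTheorem7 {G X : Type*} [Group G] [MulAction G X]
    [MeasurableSpace X] [StandardBorelSpace X] [MeasurableConstSMul G X]
    (μ : Measure X) [SigmaFinite μ] [NullSingletonClass μ] [SMulInvariantMeasure G X μ] (hμ : μ ≠ 0)
    (P : Measure (CountableConfig X)) (hP : IsPoissonProcessLaw μ P)
    (Q : Measure (CountableConfig (X × CountableConfig X)))
    (hQ : IsPoissonProcessLaw (μ.prod P) Q)
    (hErg : ErgodicSMul G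
      ((X × CountableConfig X) × CountableConfig (X × CountableConfig X)) ((μ.prod P).prod Q)) :
    (¬ ∃ Υ : X × CountableConfig X → Lp ℝ 1 μ,
        IsPoissonAllocation μ P Υ ∧ IsEquivariantAllocation G μ P Υ) ∧
      (¬ ∃ Υ : X × CountableConfig X → Lp ℝ 1 μ,
        IsAEPoissonAllocation μ P Υ ∧ IsEquivariantAllocation G μ P Υ) := by
  refine ⟨?_, ?_⟩
  · rintro ⟨Υ, hΥ, hG⟩
    exact IsEquivariantAllocation.not_isAEPoissonAllocation hμ hP hQ hErg
      (hΥ.isAEPoissonAllocation hP) hG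
  · rintro ⟨Υ, hΥ, hG⟩
    exact IsEquivariantAllocation.not_isAEPoissonAllocation hμ hP hQ hErg hΥ hG
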